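/- Let $V_1,V_2:\mathbb R\to\mathbb R$ be of class $C^3$ with $V_i(0)=0$, $q\,V_i'(q)>0$ for all $q\neq 0$, and $V_i(q)\to\infty$ as $|q|\to\infty$. Let $q_1^{wall},q_2^{wall}$ be non-zero real numbers and let $S=\{(q_1,q_2): q_1<q_1^{wall},\ q_2<q_2^{wall}\}$. The step system is the motion with Hamiltonian $H=H_1+H_2$, $H_i=\tfrac12p_i^2+V_i(q_i)$, in the configuration domain $\mathbb R^2\setminus S$, with elastic reflection from the boundary of $S$. Its phase space is $(\mathbb R^2\setminus S)\times\mathbb R^2$ with incoming and outgoing states identified (quotient topology): $(q_1,q_2,p_1,p_2)\sim(q_1,q_2,-p_1,p_2)$ if $q_1=q_1^{wall}$ and $q_2\le q_2^{wall}$, and $(q_1,q_2,p_1,p_2)\sim(q_1,q_2,p_1,-p_2)$ if $q_1\le q_1^{wall}$ and $q_2=q_2^{wall}$. Both $H_1$ and $H_2$ are well defined on it. Put $h_i^{step}=V_i(q_i^{wall})$ and $h^{step}=h_1^{step}+h_2^{step}$. For $h>h^{step}$ and $0<e_1<h$ let $L_h(e_1)=\{H=h,\ H_1=e_1\}$ be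 the level set $(e_1,h-e_1)$ in the iso-energy surface $\{H=h\}$. Then for every $h>h^{step}$ one has $0<h_1^{step}<h-h_2^{step}<h$, and 1. $L_h(e_1)$ is a genus one surface (homeomorphic to the torus) for $0<e_1<h_1^{step}$; 2. $L_h(e_1)$ is a genus two surface (homeomorphic to the connected sum of two tori) for $h_1^{step}<e_1<h-h_2^{step}$; 3. $L_h(e_1)$ is a genus one surface for $h-h_2^{step}<e_1<h$; 4. no level set in 1 or 3 is homeomorphic to a level set in 2, and the foliation of the iso-energy surface by the level sets $L_h(e_1)$, $0<e_1<h$, has exactly two singularities, $e_1=h_1^{step}$ and $e_1=h-h_2^{step}$: for all other values $c\in(0,h)$, and only for those, $L_h(e_1)$ is homeomorphic to $L_h(c)$ for all $e_1$ sufficiently close to $c$. -/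

import Mathlib

open Set Filter Topology

namespace StepSystem

/-- Potentials of one degree of freedom: of class `C³`, normalised by `V 0 = 0`, with a single
minimum at the origin, strictly monotone on either side of it, and increasing to infinity. -/
structure IsStepPotential (V : ℝ → ℝ) : Prop where
  contDiff : ContDiff ℝ 3 V
  map_zero : V 0 = 0
  mul_deriv_pos : ∀ q : ℝ, q ≠ 0 → 0 < q * deriv V q
  tendsto_atTop : Tendsto V atTop atTop
  tendsto_atBot : Tendsto V atBot atTop

/-- Points `((q₁, q₂), (p₁, p₂))`. -/
abbrev Phase : Type := (ℝ × ℝ) × (ℝ × ℝ)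

/-- The open step with corner `w = (q₁^wall, q₂^wall)`. -/
def step (w : ℝ × ℝ) : Set (ℝ × ℝ) := {q | q.1 < w.1 ∧ q.2 < w.2}

/-- The phase points whose position is not inside the step. -/
abbrev Allowed (w : ℝ × ℝ) : Type := {z : Phase // z.1 ∉ step w}

/-- Elastic reflection: a state on the right wall of the step is glued to the state with the
opposite horizontal momentum, and a state on the upper wall to the state with the opposite
vertical momentum. The walls are closed (they contain the corner), so that the gluing is the
limit of the reflection rule at the corner. -/
inductive Impact (w : ℝ × ℝ) : Allowed w → Allowed w → Prop
  | right (z z' : Allowed w) (h₁ : z.1.1.1 = w.1) (h₂ : z.1.1.2 ≤ w.2)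
      (hz' : z'.1 = (z.1.1, (-z.1.2.1, z.1.2.2))) : Impact w z z'
  | upper (z z' : Allowed w) (h₁ : z.1.1.1 ≤ w.1) (h₂ : z.1.1.2 = w.2)
      (hz' : z'.1 = (z.1.1, (z.1.2.1, -z.1.2.2))) : Impact w z z'

/-- The phase space of the step system: the allowed states with pre- and post-impact states
identified, with the quotient topology. -/
abbrev PhaseSpace (w : ℝ × ℝ) : Type := Quot (Impact w)

/-- The horizontal energy `p₁² / 2 + V₁ q₁`, which is preserved by impacts. -/
noncomputable def energy₁ (V₁ : ℝ → ℝ) (w : ℝ × ℝ) : PhaseSpace w → ℝ :=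
  Quot.lift (fun z => z.1.2.1 ^ 2 / 2 + V₁ z.1.1.1) (by
    intro a b hab
    cases hab with
    | right _ _ hz' => simp [hz']
    | upper _ _ hz' => simp [hz'])

/-- The vertical energy `p₂² / 2 + V₂ q₂`, which is preserved by impacts. -/
noncomputable def energy₂ (V₂ : ℝ → ℝ) (w : ℝ × ℝ) : PhaseSpace w → ℝ :=
  Quot.lift (fun z => z.1.2.2 ^ 2 / 2 + V₂ z.1.1.2) (by
    intro a b hab
    cases hab with
    | right _ _ hz' => simp [hz']
    | upper _ _ hz' => simp [hz'])

/-- The iso-energy surface `H = H₁ + H₂ = h` of the step system. -/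
def energySurface (V₁ V₂ : ℝ → ℝ) (w : ℝ × ℝ) (h : ℝ) : Set (PhaseSpace w) :=
  {z | energy₁ V₁ w z + energy₂ V₂ w z = h}

/-- The leaf with horizontal energy `e` of the foliation of the iso-energy surface `H = h`, that
is, the level set `(e₁, e₂) = (e, h - e)`. -/
def levelSet (V₁ V₂ : ℝ → ℝ) (w : ℝ × ℝ) (h e : ℝ) : Set (PhaseSpace w) :=
  {z | z ∈ energySurface V₁ V₂ w h ∧ energy₁ V₁ w z = e}

/-- A genus one surface: a space homeomorphic to the torus. -/
def IsGenusOneSurface (X : Type) [TopologicalSpace X] : Prop :=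
  Nonempty (X ≃ₜ Circle × Circle)

/-- The torus with an open disc (a product of two open half circles) removed. -/
abbrev HoledTorus : Type :=
  {x : Circle × Circle // ¬ ((x.1 : ℂ).re < 0 ∧ (x.2 : ℂ).re < 0)}

/-- Gluing of two copies of the holed torus along the boundary circle of the hole, i.e. along the
points of the holed torus that lie in the closure of the removed disc. -/
inductive Seam : HoledTorus ⊕ HoledTorus → HoledTorus ⊕ HoledTorus → Prop
  | glue (x : HoledTorus) (h₁ : (x.1.1 : ℂ).re ≤ 0) (h₂ : (x.1.2 : ℂ).re ≤ 0) :
      Seam (Sum.inl x) (Sum.inr x)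

/-- The connected sum of two tori. -/
abbrev DoubleTorus : Type := Quot Seam

/-- A genus two surface: a space homeomorphic to the connected sum of two tori. -/
def IsGenusTwoSurface (X : Type) [TopologicalSpace X] : Prop :=
  Nonempty (X ≃ₜ DoubleTorus)

/-- The foliation of the iso-energy surface `H = h` is topologically trivial near the leaf `c`: all
leaves with horizontal energy close to `c` are homeomorphic to it. -/
def IsRegularValue (V₁ V₂ : ℝ → ℝ) (w : ℝ × ℝ) (h c : ℝ) : Prop :=
  ∀ᶠ e in 𝓝 c, Nonempty (levelSet V₁ V₂ w h e ≃ₜ levelSet V₁ V₂ w h c)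

end StepSystem

/-! Each level curve of one degree of freedom is a circle, cut open at its right turning point and
parametrised by `[-2, 2]`, with the wall at `±1` whenever the curve crosses it. A leaf is then a
compact subset of the square modulo sign changes of the two parameters
(`nonempty_homeomorph_levelSet`). As the phase space is Hausdorff, only fibres have to be compared
with those of a map onto a model surface (`nonempty_homeomorph_of_fibers`).

If the horizontal energy is below the step, the leaf is a circle times either a full circle or an
arc closed up by reflection (`isGenusOneSurface_of_lt`); exchanging the degrees of freedom covers
high horizontal energy. In between, the parameters form a square annulus. Its outer boundary is
glued at turning points and its inner boundary at walls, in the same pattern, so the middle curve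
cuts it into two holed tori (`isGenusTwoSurface_of_mem_Ioo`).

The genera are separated by the rank of the group of homotopy classes of maps to the circle: any
three classes on the torus are dependent, but not on the double torus (`HasMonomialLogs`). The leaf
type therefore changes across both critical energies. -/

namespace StepSystem

/-! ### Separation of points in the phase space -/

/-- Explicit form of the equivalence relation generated by `Impact`. -/
def Glued (w : ℝ × ℝ) (z z' : Allowed w) : Prop :=
  z'.1.1 = z.1.1 ∧
  (z'.1.2.1 = z.1.2.1 ∨ z'.1.2.1 = -z.1.2.1 ∧ z.1.1.1 = w.1 ∧ z.1.1.2 ≤ w.2) ∧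
  (z'.1.2.2 = z.1.2.2 ∨ z'.1.2.2 = -z.1.2.2 ∧ z.1.1.1 ≤ w.1 ∧ z.1.1.2 = w.2)

/-- A continuous map to a Hausdorff space that separates the points of the phase space. -/
def invariants (w : ℝ × ℝ) : PhaseSpace w → (ℝ × ℝ) × (ℝ × ℝ) × (ℝ × ℝ) :=
  Quot.lift (fun z => (z.1.1,
      (z.1.2.1 * (|z.1.1.1 - w.1| + max (z.1.1.2 - w.2) 0),
        z.1.2.2 * (|z.1.1.2 - w.2| + max (z.1.1.1 - w.1) 0)),
      (z.1.2.1 ^ 2, z.1.2.2 ^ 2))) (by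
    intro a b hab
    cases hab with
    | right h₁ h₂ hz' => simp [hz', h₁, h₂]
    | upper h₁ h₂ hz' => simp [hz', h₁, h₂])

theorem continuous_invariants (w : ℝ × ℝ) : Continuous (invariants w) :=
  continuous_quot_lift _ (by fun_prop)

theorem mk_eq_of_glued {w : ℝ × ℝ} {z z' : Allowed w} (hz : Glued w z z') :
    (Quot.mk _ z : PhaseSpace w) = Quot.mk _ z' := by
  obtain ⟨⟨⟨q₁, q₂⟩, p₁, p₂⟩, hq⟩ := z
  obtain ⟨⟨⟨q₁', q₂'⟩, p₁', p₂'⟩, hq'⟩ := z'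
  obtain ⟨h₀, h₁, h₂⟩ := hz
  simp only [Prod.mk.injEq] at h₀ h₁ h₂
  obtain ⟨rfl, rfl⟩ := h₀
  -- At the corner both momenta may flip, so the two reflections are performed one after the other.
  have first : (Quot.mk _ ⟨((q₁', q₂'), p₁, p₂), hq⟩ : PhaseSpace w) =
      Quot.mk _ ⟨((q₁', q₂'), p₁', p₂), hq⟩ := by
    rcases h₁ with rfl | ⟨rfl, h, h'⟩
    · rfl
    · exact Quot.sound (Impact.right _ _ h h' rfl)
  rw [first]
  rcases h₂ with rfl | ⟨rfl, h, h'⟩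
  · rfl
  · exact Quot.sound (Impact.upper _ _ h h' rfl)

/-- The squares fix each momentum up to sign. The weight multiplying it vanishes exactly on the
closed wall that reverses it, so the sign is lost there and nowhere else. -/
theorem glued_of_invariants_eq {w : ℝ × ℝ} {z z' : Allowed w}
    (h : invariants w (Quot.mk _ z) = invariants w (Quot.mk _ z')) : Glued w z z' := by
  obtain ⟨⟨⟨q₁, q₂⟩, p₁, p₂⟩, hq⟩ := z
  obtain ⟨⟨⟨q₁', q₂'⟩, p₁', p₂'⟩, hq'⟩ := z'
  simp only [invariants, Prod.mk.injEq] at h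
  obtain ⟨⟨rfl, rfl⟩, ⟨h₁, h₂⟩, h₃, h₄⟩ := h
  have key : ∀ {a b p p' : ℝ}, p * (|a| + max b 0) = p' * (|a| + max b 0) → p ^ 2 = p' ^ 2 →
      p' = p ∨ p' = -p ∧ a = 0 ∧ b ≤ 0 := by
    intro a b p p' h h'
    rcases sq_eq_sq_iff_eq_or_eq_neg.mp h' with rfl | rfl
    · exact Or.inl rfl
    · by_cases h0 : |a| + max b 0 = 0
      · have ha := abs_nonneg a
        have hb := le_max_right b 0
        exact Or.inr ⟨(neg_neg _).symm, abs_eq_zero.mp (by linarith),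
          le_trans (le_max_left b 0) (by linarith)⟩
      · exact Or.inl (mul_right_cancel₀ h0 h).symm
  refine ⟨rfl, ?_, ?_⟩
  · refine (key h₁ h₃).imp_right fun ⟨h, h', h''⟩ => ⟨h, sub_eq_zero.mp h', sub_nonpos.mp h''⟩
  · refine (key h₂ h₄).imp_right fun ⟨h, h', h''⟩ => ⟨h, sub_nonpos.mp h'', sub_eq_zero.mp h'⟩

theorem mk_eq_mk_iff {w : ℝ × ℝ} {z z' : Allowed w} :
    (Quot.mk _ z : PhaseSpace w) = Quot.mk _ z' ↔ Glued w z z' :=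
  ⟨fun h => glued_of_invariants_eq (congrArg _ h), mk_eq_of_glued⟩

instance (w : ℝ × ℝ) : T2Space (PhaseSpace w) :=
  T2Space.of_injective_continuous (f := invariants w)
    (by
      rintro ⟨a⟩ ⟨b⟩ h
      exact mk_eq_of_glued (glued_of_invariants_eq h))
    (continuous_invariants w)

/-! ### Comparison of compact quotients -/

/-- Two Hausdorff quotients of a compact space with the same fibres are homeomorphic. -/
theorem nonempty_homeomorph_of_fibers {K X Y : Type*} [TopologicalSpace K] [CompactSpace K]
    [TopologicalSpace X] [T2Space X] [TopologicalSpace Y] [T2Space Y] {f : K → X} {g : K → Y}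
    (hf : Continuous f) (hg : Continuous g) (hf' : Function.Surjective f)
    (hg' : Function.Surjective g) (hfg : ∀ a b, f a = f b ↔ g a = g b) : Nonempty (X ≃ₜ Y) := by
  have qf : IsQuotientMap f := hf.isClosedMap.isQuotientMap hf hf'
  have qg : IsQuotientMap g := hg.isClosedMap.isQuotientMap hg hg'
  let F : C(K, X) := ⟨f, hf⟩
  let G : C(K, Y) := ⟨g, hg⟩
  refine ⟨{ toFun := qf.lift (f := F) G fun a b h => (hfg a b).1 h
            invFun := qg.lift (f := G) F fun a b h => (hfg a b).2 h
            left_inv := ?_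
            right_inv := ?_
            continuous_toFun := ContinuousMap.continuous _
            continuous_invFun := ContinuousMap.continuous _ }⟩
  · intro x
    obtain ⟨a, rfl⟩ := hf' x
    have h₁ := DFunLike.congr_fun (qf.lift_comp (f := F) G fun a b h => (hfg a b).1 h) a
    have h₂ := DFunLike.congr_fun (qg.lift_comp (f := G) F fun a b h => (hfg a b).2 h) a
    simp only [ContinuousMap.comp_apply] at h₁ h₂
    exact (congrArg _ h₁).trans h₂
  · intro x
    obtain ⟨a, rfl⟩ := hg' x
    have h₁ := DFunLike.congr_fun (qf.lift_comp (f := F) G fun a b h => (hfg a b).1 h) a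
    have h₂ := DFunLike.congr_fun (qg.lift_comp (f := G) F fun a b h => (hfg a b).2 h) a
    simp only [ContinuousMap.comp_apply] at h₁ h₂
    exact (congrArg _ h₂).trans h₁

/-! ### Symmetry between the degrees of freedom -/

/-- Exchange of the two degrees of freedom. -/
def swapAllowed (w : ℝ × ℝ) (z : Allowed w) : Allowed w.swap :=
  ⟨(z.1.1.swap, z.1.2.swap), fun h => z.2 ⟨h.2, h.1⟩⟩

/-- Exchange of the two degrees of freedom on the phase space. -/
def swapPhase (w : ℝ × ℝ) : PhaseSpace w → PhaseSpace w.swap :=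
  Quot.map (swapAllowed w) (by
    intro a b hab
    cases hab with
    | right h₁ h₂ hz' => exact Impact.upper _ _ h₂ h₁ (by simp [swapAllowed, hz'])
    | upper h₁ h₂ hz' => exact Impact.right _ _ h₂ h₁ (by simp [swapAllowed, hz']))

theorem continuous_swapPhase (w : ℝ × ℝ) : Continuous (swapPhase w) := by
  refine continuous_quot_lift _ (continuous_quot_mk.comp ?_)
  exact Continuous.subtype_mk (by fun_prop) _

theorem swapPhase_swapPhase (w : ℝ × ℝ) (z : PhaseSpace w) :
    swapPhase w.swap (swapPhase w z) = z := by
  obtain ⟨z⟩ := z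
  rfl

theorem swapPhase_mem_levelSet {V₁ V₂ : ℝ → ℝ} {w : ℝ × ℝ} {h e : ℝ} {z : PhaseSpace w}
    (hz : z ∈ levelSet V₁ V₂ w h e) : swapPhase w z ∈ levelSet V₂ V₁ w.swap h (h - e) := by
  obtain ⟨z⟩ := z
  obtain ⟨h₁, h₂⟩ := hz
  simp only [energySurface, mem_ofPred_eq, energy₁, energy₂] at h₁ h₂
  simp only [levelSet, energySurface, mem_ofPred_eq, energy₁, energy₂, swapPhase, Quot.map,
    swapAllowed, Prod.fst_swap, Prod.snd_swap]
  constructor <;> linarith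

/-- The level sets of the system with exchanged degrees of freedom. -/
def levelSetSwap (V₁ V₂ : ℝ → ℝ) (w : ℝ × ℝ) (h e : ℝ) :
    levelSet V₁ V₂ w h e ≃ₜ levelSet V₂ V₁ w.swap h (h - e) where
  toFun z := ⟨swapPhase w z.1, swapPhase_mem_levelSet z.2⟩
  invFun z := ⟨swapPhase w.swap z.1, by
    have := swapPhase_mem_levelSet z.2
    rwa [sub_sub_cancel] at this⟩
  left_inv z := Subtype.ext (swapPhase_swapPhase w z.1)
  right_inv z := Subtype.ext (swapPhase_swapPhase w.swap z.1)
  continuous_toFun := Continuous.subtype_mk ((continuous_swapPhase w).comp continuous_subtype_val) _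
  continuous_invFun :=
    Continuous.subtype_mk ((continuous_swapPhase w.swap).comp continuous_subtype_val) _

/-! ### Potentials and their level curves -/

namespace IsStepPotential
variable {V : ℝ → ℝ} (hV : IsStepPotential V)
include hV

theorem continuous : Continuous V := hV.contDiff.continuous

theorem strictMonoOn : StrictMonoOn V (Ici 0) := by
  refine strictMonoOn_of_deriv_pos (convex_Ici 0) hV.continuous.continuousOn fun x hx => ?_
  rw [interior_Ici] at hx
  exact (pos_iff_pos_of_mul_pos (hV.mul_deriv_pos x hx.ne')).mp hx

theorem strictAntiOn : StrictAntiOn V (Iic 0) := by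
  refine strictAntiOn_of_deriv_neg (convex_Iic 0) hV.continuous.continuousOn fun x hx => ?_
  rw [interior_Iic] at hx
  exact (neg_iff_neg_of_mul_pos (hV.mul_deriv_pos x (ne_of_lt hx))).mp hx

theorem pos {x : ℝ} (hx : x ≠ 0) : 0 < V x := by
  rw [← hV.map_zero]
  rcases hx.lt_or_gt with h | h
  · exact hV.strictAntiOn h.le (self_mem_Iic) h
  · exact hV.strictMonoOn (self_mem_Ici) h.le h

/-- The sublevel sets of a step potential are intervals around the origin. -/
theorem exists_turning_points {e : ℝ} (he : 0 < e) :
    ∃ a b, a < 0 ∧ 0 < b ∧ V a = e ∧ V b = e ∧ (∀ x, V x < e ↔ a < x ∧ x < b) ∧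
      ∀ x, V x ≤ e ↔ a ≤ x ∧ x ≤ b := by
  obtain ⟨b, hb, hb'⟩ : ∃ b, 0 < b ∧ V b = e := by
    obtain ⟨B, hB, hB'⟩ := ((hV.tendsto_atTop.eventually_gt_atTop e).and
      (eventually_gt_atTop 0)).exists
    obtain ⟨b, hb, hb'⟩ := intermediate_value_Icc hB'.le hV.continuous.continuousOn
      (show e ∈ Icc (V 0) (V B) from ⟨by rw [hV.map_zero]; exact he.le, hB.le⟩)
    refine ⟨b, lt_of_le_of_ne hb.1 ?_, hb'⟩
    rintro rfl
    rw [hV.map_zero] at hb'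
    exact he.ne hb'
  obtain ⟨a, ha, ha'⟩ : ∃ a, a < 0 ∧ V a = e := by
    obtain ⟨B, hB, hB'⟩ := ((hV.tendsto_atBot.eventually_gt_atTop e).and
      (eventually_lt_atBot 0)).exists
    obtain ⟨b, hb, hb'⟩ := intermediate_value_Icc' hB'.le hV.continuous.continuousOn
      (show e ∈ Icc (V 0) (V B) from ⟨by rw [hV.map_zero]; exact he.le, hB.le⟩)
    refine ⟨b, lt_of_le_of_ne hb.2 ?_, hb'⟩
    rintro rfl
    rw [hV.map_zero] at hb'
    exact he.ne hb'
  refine ⟨a, b, ha, hb, ha', hb', fun x => ?_, fun x => ?_⟩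
  · rcases le_total x 0 with hx | hx
    · rw [← ha', hV.strictAntiOn.lt_iff_gt hx ha.le]
      exact ⟨fun h => ⟨h, hx.trans_lt hb⟩, fun h => h.1⟩
    · rw [← hb', hV.strictMonoOn.lt_iff_lt hx hb.le]
      exact ⟨fun h => ⟨ha.trans_le hx, h⟩, fun h => h.2⟩
  · rcases le_total x 0 with hx | hx
    · rw [← ha', hV.strictAntiOn.le_iff_ge hx ha.le]
      exact ⟨fun h => ⟨h, hx.trans hb.le⟩, fun h => h.1⟩
    · rw [← hb', hV.strictMonoOn.le_iff_le hx hb.le]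
      exact ⟨fun h => ⟨ha.le.trans hx, h⟩, fun h => h.2⟩

end IsStepPotential

/-- A parametrisation of the level curve `p² / 2 + V q = e` by the interval `[-2, 2]` whose end
points are both sent to the right turning point, symmetric under reversal of the momentum, and
passing over `u` at the times `±1`. -/
structure LevelParam (V : ℝ → ℝ) (e u : ℝ) (q p : ℝ → ℝ) : Prop where
  continuous_q : Continuous q
  continuous_p : Continuous p
  energy : ∀ s, |s| ≤ 2 → p s ^ 2 / 2 + V (q s) = e
  surj : ∀ x y, y ^ 2 / 2 + V x = e → ∃ s, |s| ≤ 2 ∧ q s = x ∧ p s = y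
  lt_iff : ∀ s t, q s < q t ↔ |s| < |t|
  q_one : q 1 = u
  p_neg : ∀ s, p (-s) = -p s
  p_pos : ∀ s, 0 < s → s < 2 → 0 < p s
  p_two : p 2 = 0

theorem exists_levelParam {V : ℝ → ℝ} (hV : IsStepPotential V) {e u : ℝ} (he : 0 < e)
    (hu : V u < e) : ∃ q p, LevelParam V e u q p := by
  obtain ⟨a, b, ha, hb, hVa, hVb, hlt, hle⟩ := hV.exists_turning_points he
  obtain ⟨hau, hub⟩ := (hlt u).1 hu
  -- The piecewise affine map through `(0, a)`, `(1, u)`, `(2, b)`, with slopes `u - a` and `b - u`.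
  set θ : ℝ → ℝ := fun t => u + max (t - 1) 0 * (b - u) + min (t - 1) 0 * (u - a) with hθ
  have θc : Continuous θ := by fun_prop
  have θm : StrictMono θ := by
    intro s t hst
    have hub' := sub_pos.2 hub
    have hau' := sub_pos.2 hau
    simp only [hθ]
    rcases le_total s 1 with hs | hs <;> rcases le_total t 1 with ht | ht
    · rw [max_eq_right (by linarith), max_eq_right (by linarith), min_eq_left (by linarith),
        min_eq_left (by linarith)]
      nlinarith
    · rw [max_eq_right (by linarith), max_eq_left (by linarith), min_eq_left (by linarith),
        min_eq_right (by linarith)]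
      rcases hs.lt_or_eq with hs | rfl <;> nlinarith
    · linarith
    · rw [max_eq_left (by linarith), max_eq_left (by linarith), min_eq_right (by linarith),
        min_eq_right (by linarith)]
      nlinarith
  have θ0 : θ 0 = a := by simp [hθ]
  have θ1 : θ 1 = u := by simp [hθ]
  have θ2 : θ 2 = b := by norm_num [hθ]
  -- Truncation at `0` makes `P` vanish for `t ≤ 0`, because `V a = e`; hence `P s - P (-s)` is the
  -- odd extension of the positive branch of the momentum.
  set P : ℝ → ℝ := fun t => √(2 * (e - V (θ (max t 0)))) with hP
  have Pc : Continuous P := by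
    have := hV.continuous
    fun_prop
  have P_nonpos : ∀ t ≤ 0, P t = 0 := fun t ht => by
    simp [hP, max_eq_right ht, θ0, hVa]
  have P_nonneg : ∀ t, 0 ≤ P t := fun t => Real.sqrt_nonneg _
  have P_sq : ∀ t, 0 ≤ t → t ≤ 2 → P t ^ 2 = 2 * (e - V (θ t)) := fun t h0 h2 => by
    have : V (θ t) ≤ e := (hle _).2 ⟨θ0 ▸ θm.monotone h0, θ2 ▸ θm.monotone h2⟩
    simp only [hP, max_eq_left h0]
    exact Real.sq_sqrt (by linarith)
  have p_of_nonneg : ∀ t, 0 ≤ t → P t - P (-t) = P t := fun t ht => by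
    rw [P_nonpos (-t) (by linarith), sub_zero]
  have p_of_nonpos : ∀ t, t ≤ 0 → P t - P (-t) = -P |t| := fun t ht => by
    rw [P_nonpos t ht, zero_sub, abs_of_nonpos ht]
  refine ⟨fun s => θ |s|, fun s => P s - P (-s), by fun_prop, by fun_prop, ?_, ?_, ?_, ?_, ?_, ?_,
    ?_⟩
  · intro s hs
    have := P_sq |s| (abs_nonneg s) hs
    rcases le_total 0 s with h | h
    · simp only [p_of_nonneg s h]
      rw [abs_of_nonneg h] at *
      linarith
    · simp only [p_of_nonpos s h, neg_sq]
      linarith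
  · intro x y hxy
    have hx : a ≤ x ∧ x ≤ b := (hle x).1 (by nlinarith [sq_nonneg y])
    obtain ⟨t, ht, rfl⟩ := intermediate_value_Icc (show (0 : ℝ) ≤ 2 by norm_num) θc.continuousOn
      (show x ∈ Icc (θ 0) (θ 2) by rwa [θ0, θ2])
    have hPt : P t ^ 2 = y ^ 2 := by rw [P_sq t ht.1 ht.2]; linarith
    rcases le_total 0 y with hy | hy
    · refine ⟨t, by rw [abs_of_nonneg ht.1]; exact ht.2, by simp only [abs_of_nonneg ht.1], ?_⟩
      simp only [p_of_nonneg t ht.1]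
      exact (sq_eq_sq₀ (P_nonneg t) hy).1 hPt
    · refine ⟨-t, by rw [abs_neg, abs_of_nonneg ht.1]; exact ht.2,
        by simp only [abs_neg, abs_of_nonneg ht.1], ?_⟩
      simp only [p_of_nonpos (-t) (by linarith [ht.1]), abs_neg, abs_of_nonneg ht.1]
      have := (sq_eq_sq₀ (P_nonneg t) (neg_nonneg.2 hy)).1 (by rw [hPt, neg_sq])
      linarith
  · exact fun s t => θm.lt_iff_lt
  · simp [θ1]
  · intro s
    simp
  · intro s h0 h2
    simp only [p_of_nonneg s h0.le]
    refine lt_of_le_of_ne (P_nonneg s) fun h => ?_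
    have h' := P_sq s h0.le h2.le
    have : V (θ s) < e := (hlt _).2 ⟨θ0 ▸ θm h0, θ2 ▸ θm h2⟩
    rw [← h] at h'
    linarith
  · simp only [p_of_nonneg 2 zero_le_two]
    have := P_sq 2 zero_le_two le_rfl
    rw [θ2, hVb, sub_self, mul_zero] at this
    exact pow_eq_zero_iff two_ne_zero |>.1 this

namespace LevelParam
variable {V : ℝ → ℝ} {e u : ℝ} {q p : ℝ → ℝ} (hqp : LevelParam V e u q p)
include hqp

theorem le_iff (s t : ℝ) : q s ≤ q t ↔ |s| ≤ |t| := by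
  rw [← not_lt, hqp.lt_iff, not_lt]

theorem q_eq_iff (s t : ℝ) : q s = q t ↔ |s| = |t| := by
  rw [le_antisymm_iff, hqp.le_iff, hqp.le_iff, ← le_antisymm_iff]

theorem lt_wall (s : ℝ) : q s < u ↔ |s| < 1 := by
  rw [← hqp.q_one, hqp.lt_iff, abs_one]

theorem le_wall (s : ℝ) : q s ≤ u ↔ |s| ≤ 1 := by
  rw [← hqp.q_one, hqp.le_iff, abs_one]

theorem eq_wall (s : ℝ) : q s = u ↔ |s| = 1 := by
  rw [← hqp.q_one, hqp.q_eq_iff, abs_one]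

theorem p_zero : p 0 = 0 := by
  have := hqp.p_neg 0
  rw [neg_zero] at this
  linarith

theorem p_eq_zero_iff {s : ℝ} (hs : |s| ≤ 2) : p s = 0 ↔ s = 0 ∨ |s| = 2 := by
  constructor
  · intro h
    by_contra! hc
    obtain ⟨h0, h2⟩ := hc
    have h2' := lt_of_le_of_ne hs h2
    rcases h0.lt_or_gt with h' | h'
    · have := hqp.p_pos (-s) (by linarith) (by rw [abs_of_neg h'] at h2'; exact h2')
      rw [hqp.p_neg] at this
      linarith
    · have := hqp.p_pos s h' (by rwa [abs_of_pos h'] at h2')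
      linarith
  · rintro (rfl | h)
    · exact hqp.p_zero
    · rcases (abs_eq zero_le_two).1 h with rfl | rfl
      · exact hqp.p_two
      · rw [hqp.p_neg, hqp.p_two, neg_zero]

/-- Coincidence of two points of the curve up to a possible reflection of the momentum. -/
theorem glue_iff {s t : ℝ} (hs : |s| ≤ 2) (C : Prop) :
    (q t = q s ∧ (p t = p s ∨ p t = -p s ∧ C)) ↔ (t = s ∨ t = -s ∧ (|s| = 2 ∨ C)) := by
  constructor
  · rintro ⟨h, h'⟩
    rcases abs_eq_abs.1 ((hqp.q_eq_iff _ _).1 h) with rfl | rfl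
    · exact Or.inl rfl
    · rcases h' with h' | h'
      -- Opposite parameters with equal momenta have momentum zero, hence lie at a turning point: `s
      -- = 0`, or the two ends `±2`.
      · rw [hqp.p_neg] at h'
        rcases (hqp.p_eq_zero_iff hs).1 (by linarith) with rfl | h''
        · simp
        · exact Or.inr ⟨rfl, Or.inl h''⟩
      · exact Or.inr ⟨rfl, Or.inr h'.2⟩
  · rintro (rfl | ⟨rfl, h | h⟩)
    · exact ⟨rfl, Or.inl rfl⟩
    · have := (hqp.p_eq_zero_iff hs).2 (Or.inr h)
      exact ⟨(hqp.q_eq_iff _ _).2 (abs_neg s), Or.inl (by rw [hqp.p_neg, this, neg_zero])⟩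
    · exact ⟨(hqp.q_eq_iff _ _).2 (abs_neg s), Or.inr ⟨hqp.p_neg s, h⟩⟩

end LevelParam

/-! ### Parametrisation of the circle -/

/-- The parametrisation of the circle by `[-2, 2]` in which `[-1, 1]` covers the left half. -/
noncomputable def wrap (s : ℝ) : Circle := Circle.exp (Real.pi / 2 * s + Real.pi)

@[fun_prop]
theorem continuous_wrap : Continuous wrap := by
  unfold wrap
  fun_prop

/-- The abscissa of a point of the circle as a function of its parameter. -/
noncomputable def abscissa (s : ℝ) : ℝ := -Real.cos (Real.pi / 2 * s)

@[fun_prop]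
theorem continuous_abscissa : Continuous abscissa := by
  unfold abscissa
  fun_prop

theorem re_wrap (s : ℝ) : (wrap s : ℂ).re = abscissa |s| := by
  have h : Real.cos (Real.pi / 2 * |s|) = Real.cos (Real.pi / 2 * s) := by
    rw [← Real.cos_abs (Real.pi / 2 * s), abs_mul, abs_of_pos Real.pi_div_two_pos]
  rw [wrap, abscissa, h, Circle.coe_exp, Complex.exp_ofReal_mul_I_re, Real.cos_add_pi]

theorem abscissa_one : abscissa 1 = 0 := by simp [abscissa]

theorem strictMonoOn_abscissa : StrictMonoOn abscissa (Icc 0 2) := by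
  intro s hs t ht hst
  have hpi := Real.pi_pos
  refine neg_lt_neg (Real.strictAntiOn_cos ⟨?_, ?_⟩ ⟨?_, ?_⟩ ?_)
  · exact mul_nonneg (by linarith) hs.1
  · nlinarith [hs.2]
  · exact mul_nonneg (by linarith) ht.1
  · nlinarith [ht.2]
  · nlinarith

theorem wrap_surj (z : Circle) : ∃ s, |s| ≤ 2 ∧ wrap s = z := by
  have hpi := Real.pi_pos
  set t := (z * Circle.exp (-Real.pi) : ℂ).arg with ht
  have h1 := (Complex.neg_pi_lt_arg (z * Circle.exp (-Real.pi) : ℂ)).le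
  have h2 := Complex.arg_le_pi (z * Circle.exp (-Real.pi) : ℂ)
  rw [← ht] at h1 h2
  refine ⟨2 / Real.pi * t, ?_, ?_⟩
  · rw [abs_mul, abs_of_pos (by positivity), div_mul_eq_mul_div, div_le_iff₀ hpi]
    have := abs_le.2 ⟨h1, h2⟩
    linarith
  · have h3 : Real.pi / 2 * (2 / Real.pi * t) = t := by field_simp
    have h4 : Circle.exp t = z * Circle.exp (-Real.pi) := Circle.exp_arg (z * Circle.exp (-Real.pi))
    rw [wrap, h3, Circle.exp_add, h4, mul_assoc, ← Circle.exp_add]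
    simp

/-- The period is `4`, the length of the interval, so distinct parameters with one image can only be
the two ends. -/
theorem wrap_eq_iff {s t : ℝ} (hs : |s| ≤ 2) (ht : |t| ≤ 2) :
    wrap s = wrap t ↔ t = s ∨ t = -s ∧ |s| = 2 := by
  have hpi := Real.pi_pos
  rw [abs_le] at hs ht
  constructor
  · intro h
    obtain ⟨m, hm⟩ := Circle.exp_eq_exp.1 h
    have hm' : s = t + 4 * m := by
      have : Real.pi * (s - t - 4 * m) = 0 := by linarith
      rcases mul_eq_zero.1 this with h | h
      · exact absurd h hpi.ne'
      · linarith
    have h1 : (-1 : ℝ) ≤ m := by linarith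
    have h2 : (m : ℝ) ≤ 1 := by linarith
    have h1' : -1 ≤ m := by exact_mod_cast h1
    have h2' : m ≤ 1 := by exact_mod_cast h2
    interval_cases m
    · right
      have : s = -2 := by norm_num at hm'; linarith
      have : t = 2 := by norm_num at hm'; linarith
      subst s t
      norm_num
    · left
      norm_num at hm'
      exact hm'.symm
    · right
      have : s = 2 := by norm_num at hm'; linarith
      have : t = -2 := by norm_num at hm'; linarith
      subst s t
      norm_num
  · rintro (rfl | ⟨rfl, h⟩)
    · rfl
    · refine Circle.exp_eq_exp.2 ?_
      rcases (abs_eq zero_le_two).1 h with rfl | rfl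
      · exact ⟨1, by push_cast; ring⟩
      · exact ⟨-1, by push_cast; ring⟩

/-! ### The double torus as a Hausdorff space -/

/-- A model of the connected sum of two tori: the double of the holed torus, embedded in the product
of the torus with a line. -/
def embeddedDouble : Set ((Circle × Circle) × ℝ) :=
  {x | |x.2| = max (x.1.1 : ℂ).re (x.1.2 : ℂ).re}

theorem holedTorus_nonneg (x : HoledTorus) :
    0 ≤ max (x.1.1 : ℂ).re (x.1.2 : ℂ).re := by
  by_contra! h
  exact x.2 (max_lt_iff.1 h)

/-- The map from the connected sum of two tori to its embedded model. -/
noncomputable def toEmbeddedDouble : DoubleTorus → embeddedDouble :=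
  Quot.lift (Sum.elim
      (fun x => ⟨(x.1, max (x.1.1 : ℂ).re (x.1.2 : ℂ).re), abs_of_nonneg (holedTorus_nonneg x)⟩)
      (fun x => ⟨(x.1, -max (x.1.1 : ℂ).re (x.1.2 : ℂ).re),
        (abs_neg _).trans (abs_of_nonneg (holedTorus_nonneg x))⟩))
    (by
      rintro _ _ ⟨x, h₁, h₂⟩
      have : max (x.1.1 : ℂ).re (x.1.2 : ℂ).re = 0 :=
        le_antisymm (max_le h₁ h₂) (holedTorus_nonneg x)
      simp [this])

theorem continuous_circle_re : Continuous fun z : Circle => (z : ℂ).re :=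
  Complex.continuous_re.comp continuous_subtype_val

theorem continuous_toEmbeddedDouble : Continuous toEmbeddedDouble := by
  have hc : Continuous fun x : HoledTorus => max (x.1.1 : ℂ).re (x.1.2 : ℂ).re :=
    (continuous_circle_re.comp (continuous_fst.comp continuous_subtype_val)).max
      (continuous_circle_re.comp (continuous_snd.comp continuous_subtype_val))
  refine continuous_quot_lift _ (Continuous.sumElim ?_ ?_)
  · exact Continuous.subtype_mk (continuous_subtype_val.prodMk hc) _
  · exact Continuous.subtype_mk (continuous_subtype_val.prodMk hc.neg) _

/-- The two copies lie at heights of opposite sign and meet only at height zero, where both real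
parts are nonpositive: on the seam. -/
theorem injective_toEmbeddedDouble : Function.Injective toEmbeddedDouble := by
  have seam : ∀ x y : HoledTorus,
      ((x.1, max (x.1.1 : ℂ).re (x.1.2 : ℂ).re) : (Circle × Circle) × ℝ) =
        (y.1, -max (y.1.1 : ℂ).re (y.1.2 : ℂ).re) →
      (Quot.mk _ (Sum.inl x) : DoubleTorus) = Quot.mk _ (Sum.inr y) := by
    intro x y h
    obtain ⟨h₁, h₂⟩ := Prod.mk.inj h
    obtain rfl := Subtype.ext h₁
    have h0 : max (x.1.1 : ℂ).re (x.1.2 : ℂ).re ≤ 0 := by linarith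
    exact Quot.sound (Seam.glue x (max_le_iff.1 h0).1 (max_le_iff.1 h0).2)
  rintro ⟨x | x⟩ ⟨y | y⟩ h
  · exact congrArg (fun z => Quot.mk _ (Sum.inl z))
      (Subtype.ext (Prod.mk.inj (Subtype.mk.inj h)).1)
  · exact seam x y (Subtype.mk.inj h)
  · exact (seam y x (Subtype.mk.inj h).symm).symm
  · exact congrArg (fun z => Quot.mk _ (Sum.inr z))
      (Subtype.ext (Prod.mk.inj (Subtype.mk.inj h)).1)

theorem surjective_toEmbeddedDouble : Function.Surjective toEmbeddedDouble := by
  rintro ⟨⟨x, t⟩, h⟩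
  have h : |t| = max (x.1 : ℂ).re (x.2 : ℂ).re := h
  have hx : ¬ ((x.1 : ℂ).re < 0 ∧ (x.2 : ℂ).re < 0) := fun h' =>
    (max_lt h'.1 h'.2).not_ge (h ▸ abs_nonneg t)
  rcases le_total 0 t with h0 | h0
  · refine ⟨Quot.mk _ (Sum.inl ⟨x, hx⟩), Subtype.ext (Prod.ext rfl ?_)⟩
    rw [abs_of_nonneg h0] at h
    exact h.symm
  · refine ⟨Quot.mk _ (Sum.inr ⟨x, hx⟩), Subtype.ext (Prod.ext rfl ?_)⟩
    rw [abs_of_nonpos h0] at h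
    exact neg_eq_iff_eq_neg.2 (h.symm.trans rfl)

instance : CompactSpace HoledTorus := by
  refine isCompact_iff_compactSpace.1 (IsClosed.isCompact ?_)
  have : IsOpen {x : Circle × Circle | (x.1 : ℂ).re < 0 ∧ (x.2 : ℂ).re < 0} :=
    (isOpen_lt (continuous_circle_re.comp continuous_fst) continuous_const).inter
      (isOpen_lt (continuous_circle_re.comp continuous_snd) continuous_const)
  exact this.isClosed_compl

instance : T2Space DoubleTorus :=
  T2Space.of_injective_continuous injective_toEmbeddedDouble continuous_toEmbeddedDouble

theorem nonempty_homeomorph_embeddedDouble : Nonempty (embeddedDouble ≃ₜ DoubleTorus) :=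
  nonempty_homeomorph_of_fibers (K := DoubleTorus) continuous_toEmbeddedDouble continuous_id
    surjective_toEmbeddedDouble Function.surjective_id
    fun _ _ => injective_toEmbeddedDouble.eq_iff

/-! ### Leaves as quotients of parameter sets, and genus one -/

/-- The level set as the quotient of a compact set of parameters. -/
theorem nonempty_homeomorph_levelSet {V₁ V₂ : ℝ → ℝ} {w : ℝ × ℝ} {h e u₁ u₂ : ℝ}
    {q₁ p₁ q₂ p₂ : ℝ → ℝ} (h₁ : LevelParam V₁ e u₁ q₁ p₁) (h₂ : LevelParam V₂ (h - e) u₂ q₂ p₂)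
    {K : Set (ℝ × ℝ)} (hK : IsClosed K)
    (hmem : ∀ v : ℝ × ℝ, v ∈ K ↔ |v.1| ≤ 2 ∧ |v.2| ≤ 2 ∧ (q₁ v.1, q₂ v.2) ∉ step w)
    {X : Type*} [TopologicalSpace X] [T2Space X] {f : K → X} (hf : Continuous f)
    (hf' : Function.Surjective f)
    (hker : ∀ v v' : K, f v = f v' ↔
      (v'.1.1 = v.1.1 ∨ v'.1.1 = -v.1.1 ∧ (|v.1.1| = 2 ∨ q₁ v.1.1 = w.1 ∧ q₂ v.1.2 ≤ w.2)) ∧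
      (v'.1.2 = v.1.2 ∨ v'.1.2 = -v.1.2 ∧ (|v.1.2| = 2 ∨ q₁ v.1.1 ≤ w.1 ∧ q₂ v.1.2 = w.2))) :
    Nonempty (levelSet V₁ V₂ w h e ≃ₜ X) := by
  have hKc : IsCompact K := by
    refine (isCompact_Icc (a := ((-2, -2) : ℝ × ℝ)) (b := (2, 2))).of_isClosed_subset hK ?_
    intro v hv
    obtain ⟨hv1, hv2, -⟩ := (hmem v).1 hv
    exact ⟨⟨(abs_le.1 hv1).1, (abs_le.1 hv2).1⟩, ⟨(abs_le.1 hv1).2, (abs_le.1 hv2).2⟩⟩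
  have := isCompact_iff_compactSpace.1 hKc
  let pt : K → Allowed w := fun v =>
    ⟨((q₁ v.1.1, q₂ v.1.2), (p₁ v.1.1, p₂ v.1.2)), ((hmem v.1).1 v.2).2.2⟩
  have hpt : Continuous pt := by
    have c1 := h₁.continuous_q
    have c2 := h₂.continuous_q
    have c3 := h₁.continuous_p
    have c4 := h₂.continuous_p
    exact Continuous.subtype_mk (by fun_prop) _
  have hg : ∀ v, (Quot.mk _ (pt v) : PhaseSpace w) ∈ levelSet V₁ V₂ w h e := by
    intro v
    obtain ⟨hv1, hv2, -⟩ := (hmem v.1).1 v.2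
    have e1 : energy₁ V₁ w (Quot.mk _ (pt v)) = e := h₁.energy _ hv1
    have e2 : energy₂ V₂ w (Quot.mk _ (pt v)) = h - e := h₂.energy _ hv2
    exact ⟨by simp only [energySurface, mem_ofPred_eq, e1, e2]; ring, e1⟩
  refine nonempty_homeomorph_of_fibers (K := K)
    (f := fun v => (⟨Quot.mk _ (pt v), hg v⟩ : levelSet V₁ V₂ w h e)) (g := f)
    (Continuous.subtype_mk (continuous_quot_mk.comp hpt) _) hf ?_ hf' ?_
  · rintro ⟨⟨z⟩, hz, hz'⟩
    obtain ⟨⟨⟨x₁, x₂⟩, y₁, y₂⟩, hx⟩ := z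
    have e1 : y₁ ^ 2 / 2 + V₁ x₁ = e := hz'
    have e2 : y₁ ^ 2 / 2 + V₁ x₁ + (y₂ ^ 2 / 2 + V₂ x₂) = h := hz
    obtain ⟨s, hs, rfl, rfl⟩ := h₁.surj _ _ e1
    obtain ⟨t, ht, rfl, rfl⟩ := h₂.surj x₂ y₂ (by linarith)
    exact ⟨⟨(s, t), (hmem _).2 ⟨hs, ht, hx⟩⟩, rfl⟩
  · intro v v'
    obtain ⟨hv1, hv2, -⟩ := (hmem v.1).1 v.2
    rw [hker, Subtype.mk.injEq, mk_eq_mk_iff, ← h₁.glue_iff hv1, ← h₂.glue_iff hv2]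
    simp only [Glued, pt, Prod.mk.injEq]
    tauto

theorem lt_wall_of_pos {V : ℝ → ℝ} (hV : IsStepPotential V) {x u : ℝ} (hu : 0 < u)
    (h : V x < V u) : x < u := by
  by_contra! hx
  exact (hV.strictMonoOn.monotoneOn hu.le (hu.le.trans hx) hx).not_gt h

theorem wall_lt_of_neg {V : ℝ → ℝ} (hV : IsStepPotential V) {x u : ℝ} (hu : u < 0)
    (h : V x < V u) : u < x := by
  by_contra! hx
  exact (hV.strictAntiOn.antitoneOn (hx.trans hu.le) hu.le hx).not_gt h

theorem LevelParam.potential_le {V : ℝ → ℝ} {e u : ℝ} {q p : ℝ → ℝ} (h : LevelParam V e u q p)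
    {s : ℝ} (hs : |s| ≤ 2) : V (q s) ≤ e := by
  have := h.energy s hs
  nlinarith [sq_nonneg (p s)]

theorem isClosed_abs_le : IsClosed {v : ℝ × ℝ | |v.1| ≤ 2} ∧ IsClosed {v : ℝ × ℝ | |v.2| ≤ 2} :=
  ⟨isClosed_le continuous_fst.abs continuous_const, isClosed_le continuous_snd.abs continuous_const⟩

/-- The stretching of the two outer quarters of `[-2, 2]` over the two halves. -/
def stretch (s : ℝ) : ℝ := 2 * (s - max (-1) (min s 1))

theorem continuous_stretch : Continuous stretch := by
  unfold stretch
  fun_prop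

theorem stretch_neg (s : ℝ) : stretch (-s) = -stretch s := by
  unfold stretch
  grind

theorem abs_stretch {s : ℝ} (hs : 1 ≤ |s|) : |stretch s| = 2 * |s| - 2 := by
  unfold stretch
  grind

theorem stretch_of_pos {s : ℝ} (hs : 1 ≤ s) : stretch s = 2 * s - 2 := by
  unfold stretch
  grind

theorem stretch_of_neg {s : ℝ} (hs : s ≤ -1) : stretch s = 2 * s + 2 := by
  unfold stretch
  grind

/-- The horizontal motion never reaches the line of the right wall. If that line is on its left, no
wall is met. If it is on its right, the vertical motion keeps above the upper wall, and the
reflection closes its arc `1 ≤ |t| ≤ 2` to a circle. -/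
theorem isGenusOneSurface_of_lt {V₁ V₂ : ℝ → ℝ} (hV₁ : IsStepPotential V₁)
    (hV₂ : IsStepPotential V₂) {w : ℝ × ℝ} (hw₁ : w.1 ≠ 0) {h e : ℝ}
    (hh : V₁ w.1 + V₂ w.2 < h) (he : 0 < e) (he' : e < V₁ w.1) (heh : e < h) :
    IsGenusOneSurface (levelSet V₁ V₂ w h e) := by
  -- The wall is off this curve, so the position marked at `±1` is immaterial.
  obtain ⟨q₁, p₁, h₁⟩ := exists_levelParam hV₁ he (u := 0) (by rwa [hV₁.map_zero])
  rcases hw₁.lt_or_gt with hw | hw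
  · obtain ⟨q₂, p₂, h₂⟩ := exists_levelParam hV₂ (sub_pos.2 heh) (u := 0)
      (by rw [hV₂.map_zero]; linarith)
    have hq : ∀ s, |s| ≤ 2 → w.1 < q₁ s := fun s hs =>
      wall_lt_of_neg hV₁ hw ((h₁.potential_le hs).trans_lt he')
    refine nonempty_homeomorph_levelSet h₁ h₂ (K := {v | |v.1| ≤ 2 ∧ |v.2| ≤ 2})
      (f := fun v => (wrap v.1.1, wrap v.1.2)) ?_ ?_ ?_ ?_ ?_
    · exact isClosed_abs_le.1.inter isClosed_abs_le.2
    · intro v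
      refine ⟨fun hv => ⟨hv.1, hv.2, fun hv' => (hq _ hv.1).not_gt hv'.1⟩, fun hv => ⟨hv.1, hv.2.1⟩⟩
    · fun_prop
    · rintro ⟨x, y⟩
      obtain ⟨s, hs, rfl⟩ := wrap_surj x
      obtain ⟨t, ht, rfl⟩ := wrap_surj y
      exact ⟨⟨(s, t), hs, ht⟩, rfl⟩
    · rintro ⟨v, hv1, hv2⟩ ⟨v', hv1', hv2'⟩
      have := hq _ hv1
      rw [Prod.mk.injEq, wrap_eq_iff hv1 hv1', wrap_eq_iff hv2 hv2']
      simp only [this.ne', this.not_ge, false_and, or_false]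
  · obtain ⟨q₂, p₂, h₂⟩ := exists_levelParam hV₂ (sub_pos.2 heh) (u := w.2) (by linarith)
    have hq : ∀ s, |s| ≤ 2 → q₁ s < w.1 := fun s hs =>
      lt_wall_of_pos hV₁ hw ((h₁.potential_le hs).trans_lt he')
    refine nonempty_homeomorph_levelSet h₁ h₂ (K := {v | |v.1| ≤ 2 ∧ |v.2| ≤ 2 ∧ 1 ≤ |v.2|})
      (f := fun v => (wrap v.1.1, wrap (stretch v.1.2))) ?_ ?_ ?_ ?_ ?_
    · exact isClosed_abs_le.1.inter
        (isClosed_abs_le.2.inter (isClosed_le continuous_const continuous_snd.abs))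
    · intro v
      refine and_congr_right fun hv => and_congr_right fun _ => ?_
      simp only [step, mem_ofPred_eq, hq _ hv, true_and, h₂.lt_wall, not_lt]
    · have := continuous_stretch
      fun_prop
    · rintro ⟨x, y⟩
      obtain ⟨s, hs, rfl⟩ := wrap_surj x
      obtain ⟨t, ht, rfl⟩ := wrap_surj y
      rw [abs_le] at ht
      rcases le_total 0 t with h0 | h0
      · have ha : |t / 2 + 1| = t / 2 + 1 := abs_of_nonneg (by linarith)
        refine ⟨⟨(s, t / 2 + 1), hs, ?_, ?_⟩, ?_⟩
        · rw [ha]; linarith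
        · rw [ha]; linarith
        · refine Prod.ext rfl (congrArg wrap ?_)
          dsimp only
          rw [stretch_of_pos (by linarith)]
          ring
      · have ha : |t / 2 - 1| = 1 - t / 2 := by rw [abs_of_nonpos (by linarith)]; ring
        refine ⟨⟨(s, t / 2 - 1), hs, ?_, ?_⟩, ?_⟩
        · rw [ha]; linarith
        · rw [ha]; linarith
        · refine Prod.ext rfl (congrArg wrap ?_)
          dsimp only
          rw [stretch_of_neg (by linarith)]
          ring
    · rintro ⟨v, hv1, hv2, hv3⟩ ⟨v', hv1', hv2', hv3'⟩
      have hlt := hq _ hv1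
      have a1 := abs_stretch hv3
      have a2 := abs_stretch hv3'
      rw [Prod.mk.injEq, wrap_eq_iff hv1 hv1', wrap_eq_iff (by linarith) (by linarith)]
      simp only [hlt.ne, hlt.le, false_and, or_false, true_and, h₂.eq_wall]
      refine and_congr_right fun _ => ?_
      constructor
      · rintro (h | ⟨h, h'⟩)
        · have habs : |v'.2| = |v.2| := by
            have := congrArg abs h
            linarith
          rcases abs_eq_abs.1 habs with h' | h'
          · exact Or.inl h'
          -- Here the stretched parameter is its own negative, hence zero: the point is on the upper
          -- wall.
          · rw [h', stretch_neg] at h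
            have h0 : stretch v.2 = 0 := by linarith
            rw [h0, abs_zero] at a1
            exact Or.inr ⟨h', Or.inr (by linarith)⟩
        · have habs : |v'.2| = |v.2| := by
            have := congrArg abs h
            rw [abs_neg] at this
            linarith
          have h2 : |v.2| = 2 := by linarith
          exact (abs_eq_abs.1 habs).imp_right fun h => ⟨h, Or.inl h2⟩
      · rintro (h | ⟨h, h' | h'⟩)
        · rw [h]; exact Or.inl rfl
        · right
          rw [h, stretch_neg]
          exact ⟨rfl, by linarith⟩
        · left
          have h0 : stretch v.2 = 0 := abs_eq_zero.1 (by linarith)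
          rw [h, stretch_neg, h0, neg_zero]

/-! ### The annulus and genus two -/

/-- The factor by which a point of the annulus `1 ≤ max |s| |t| ≤ 2` at maximum norm `r` is moved
radially, so that each half of the annulus is spread over the whole. -/
noncomputable def radial (r : ℝ) : ℝ := (1 + |2 * r - 3|) / r

/-- The height over the torus of the points of the annulus at maximum norm `r`. -/
noncomputable def height (r : ℝ) : ℝ :=
  abscissa (1 + max (2 * r - 3) 0) - abscissa (1 + max (3 - 2 * r) 0)

theorem continuous_height : Continuous height := by
  unfold height
  fun_prop

theorem radial_mul {r : ℝ} (hr : 1 ≤ r) : r * radial r = 1 + |2 * r - 3| := by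
  rw [radial, mul_div_cancel₀ _ (by linarith)]

theorem radial_pos {r : ℝ} (hr : 1 ≤ r) : 0 < radial r := by
  unfold radial
  positivity

theorem height_of_ge {r : ℝ} (hr : 3 / 2 ≤ r) : height r = abscissa (1 + |2 * r - 3|) := by
  rw [height, max_eq_left (by linarith), max_eq_right (by linarith), add_zero, abscissa_one,
    abs_of_nonneg (by linarith), sub_zero]

theorem height_of_le {r : ℝ} (hr : r ≤ 3 / 2) : height r = -abscissa (1 + |2 * r - 3|) := by
  rw [height, max_eq_right (by linarith), max_eq_left (by linarith), add_zero, abscissa_one,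
    abs_of_nonpos (by linarith), zero_sub, neg_sub]

/-- The height increases strictly, from negative values on the inner half through zero at `3 / 2` to
positive ones, so it recovers the norm that the radial folding forgets. -/
theorem injOn_height : InjOn height (Icc 1 2) := by
  have mono : ∀ s ∈ Icc (1 : ℝ) 2, ∀ t ∈ Icc (1 : ℝ) 2, s < t → height s < height t := by
    intro s hs t ht hst
    obtain ⟨hs1, hs2⟩ := hs
    obtain ⟨ht1, ht2⟩ := ht
    have m : ∀ {x y : ℝ}, x ∈ Icc (1 : ℝ) 2 → y ∈ Icc (1 : ℝ) 2 → (abscissa x < abscissa y ↔ x < y) :=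
      fun hx hy => strictMonoOn_abscissa.lt_iff_lt ⟨by linarith [hx.1], hx.2⟩
        ⟨by linarith [hy.1], hy.2⟩
    have n : ∀ {x : ℝ}, x ∈ Icc (1 : ℝ) 2 → 0 ≤ abscissa x := fun hx => by
      rw [← abscissa_one]
      exact strictMonoOn_abscissa.monotoneOn (by norm_num) ⟨by linarith [hx.1], hx.2⟩ hx.1
    have r : ∀ {x : ℝ}, 1 ≤ x → x ≤ 2 → 1 + |2 * x - 3| ∈ Icc (1 : ℝ) 2 := fun {x} h h' => by
      have h1 := abs_nonneg (2 * x - 3)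
      have h2 : |2 * x - 3| ≤ 1 := abs_le.2 ⟨by linarith, by linarith⟩
      exact ⟨by linarith, by linarith⟩
    rcases le_total s (3 / 2) with h | h
    · rcases le_total t (3 / 2) with h' | h'
      · rw [height_of_le h, height_of_le h', neg_lt_neg_iff, m (r ht1 ht2) (r hs1 hs2),
          abs_of_nonpos (by linarith), abs_of_nonpos (by linarith)]
        linarith
      · rw [height_of_le h, height_of_ge h']
        rcases h.lt_or_eq with h0 | h0
        · have : abscissa 1 < abscissa (1 + |2 * s - 3|) := by
            rw [m (by norm_num) (r hs1 hs2), abs_of_nonpos (by linarith)]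
            linarith
          rw [abscissa_one] at this
          linarith [n (r ht1 ht2)]
        · have : abscissa 1 < abscissa (1 + |2 * t - 3|) := by
            rw [m (by norm_num) (r ht1 ht2), abs_of_nonneg (by linarith)]
            linarith
          rw [abscissa_one] at this
          linarith [n (r hs1 hs2)]
    · have h' := h.trans hst.le
      rw [height_of_ge h, height_of_ge h', m (r hs1 hs2) (r ht1 ht2),
        abs_of_nonneg (by linarith), abs_of_nonneg (by linarith)]
      linarith
  intro s hs t ht hst
  rcases lt_trichotomy s t with h | h | h
  · exact absurd hst (mono s hs t ht h).ne
  · exact h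
  · exact absurd hst (mono t ht s hs h).ne'

/-- The annulus `1 ≤ max |s| |t| ≤ 2`. -/
def annulus : Set (ℝ × ℝ) := {v | |v.1| ≤ 2 ∧ |v.2| ≤ 2 ∧ 1 ≤ max |v.1| |v.2|}

/-- The new maximum norm `1 + |2 * r - 3|` reaches `2` only on the two boundary curves, so `wrap`
makes identifications only there. -/
theorem abs_mul_radial_le {s r : ℝ} (hr : 1 ≤ r) (hr' : r ≤ 2) (hs : |s| ≤ r) :
    |s * radial r| ≤ 2 ∧ (|s * radial r| = 2 ↔ |s| = r ∧ (r = 1 ∨ r = 2)) := by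
  have hp := radial_pos hr
  have hm := radial_mul hr
  rw [abs_mul, abs_of_pos hp]
  have h1 : |s| * radial r ≤ r * radial r := mul_le_mul_of_nonneg_right hs hp.le
  have h2 : |2 * r - 3| ≤ 1 := abs_le.2 ⟨by linarith, by linarith⟩
  refine ⟨by linarith, fun h => ?_, ?_⟩
  · have h3 : |2 * r - 3| = 1 := by linarith
    refine ⟨mul_right_cancel₀ hp.ne' (by linarith), ?_⟩
    rcases (abs_eq zero_le_one).1 h3 with h | h
    · right; linarith
    · left; linarith
  · rintro ⟨h, rfl | rfl⟩
    · rw [h, hm]; norm_num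
    · rw [h, hm]; norm_num

/-- The quotient map from the annulus to the double of the holed torus. -/
noncomputable def annulusMap (v : annulus) : embeddedDouble :=
  ⟨((wrap (v.1.1 * radial (max |v.1.1| |v.1.2|)), wrap (v.1.2 * radial (max |v.1.1| |v.1.2|))),
    height (max |v.1.1| |v.1.2|)), by
    obtain ⟨⟨s, t⟩, hs, ht, hr⟩ := v
    dsimp only at hs ht hr ⊢
    set r := max |s| |t| with hrdef
    have hr' : r ≤ 2 := max_le hs ht
    obtain ⟨hs', -⟩ := abs_mul_radial_le hr hr' (le_max_left |s| |t|)
    obtain ⟨ht', -⟩ := abs_mul_radial_le hr hr' (le_max_right |s| |t|)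
    have hp := radial_pos hr
    have h2 : |2 * r - 3| ≤ 1 := abs_le.2 ⟨by linarith, by linarith⟩
    -- Monotonicity lets `abscissa` commute with the maximum.
    have hmax : max (abscissa |s * radial r|) (abscissa |t * radial r|) =
        abscissa (1 + |2 * r - 3|) := by
      rw [← strictMonoOn_abscissa.monotoneOn.map_max ⟨abs_nonneg _, hs'⟩ ⟨abs_nonneg _, ht'⟩,
        abs_mul, abs_mul, abs_of_pos hp, ← max_mul_of_nonneg _ _ hp.le, radial_mul hr]
    have hnn : 0 ≤ abscissa (1 + |2 * r - 3|) := by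
      rw [← abscissa_one]
      exact strictMonoOn_abscissa.monotoneOn (by norm_num) ⟨by positivity, by linarith⟩
        (by linarith [abs_nonneg (2 * r - 3)])
    simp only [embeddedDouble, mem_ofPred_eq, re_wrap]
    rw [hmax]
    rcases le_total r (3 / 2) with h | h
    · rw [height_of_le h, abs_neg, abs_of_nonneg hnn]
    · rw [height_of_ge h, abs_of_nonneg hnn]⟩

theorem continuous_annulusMap : Continuous annulusMap := by
  refine Continuous.subtype_mk ?_ _
  have hr : Continuous fun v : annulus => max |v.1.1| |v.1.2| := by fun_prop
  have hrad : Continuous fun v : annulus => radial (max |v.1.1| |v.1.2|) := by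
    refine Continuous.div (by fun_prop) hr fun v => ?_
    exact (zero_lt_one.trans_le v.2.2.2).ne'
  have hh := continuous_height.comp hr
  exact ((continuous_wrap.comp ((by fun_prop : Continuous fun v : annulus => v.1.1).mul hrad)).prodMk
    (continuous_wrap.comp ((by fun_prop : Continuous fun v : annulus => v.1.2).mul hrad))).prodMk hh

theorem surjective_annulusMap : Function.Surjective annulusMap := by
  rintro ⟨⟨⟨x, y⟩, k⟩, hk⟩
  obtain ⟨s, hs, rfl⟩ := wrap_surj x
  obtain ⟨t, ht, rfl⟩ := wrap_surj y
  simp only [embeddedDouble, mem_ofPred_eq, re_wrap] at hk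
  rw [← strictMonoOn_abscissa.monotoneOn.map_max ⟨abs_nonneg _, hs⟩ ⟨abs_nonneg _, ht⟩] at hk
  set m := max |s| |t| with hm
  have hm2 : m ≤ 2 := max_le hs ht
  have hm0 : 0 ≤ m := (abs_nonneg s).trans (le_max_left _ _)
  have hm1 : 1 ≤ m := by
    refine (strictMonoOn_abscissa.le_iff_le (by norm_num) ⟨hm0, hm2⟩).1 ?_
    rw [abscissa_one, ← hk]
    exact abs_nonneg k
  -- The sign of `k` selects the outer or inner half, on which `1 + |2 * r - 3| = m` has one
  -- solution.
  obtain ⟨r, hr1, hr2, hrm, hrk⟩ : ∃ r, 1 ≤ r ∧ r ≤ 2 ∧ 1 + |2 * r - 3| = m ∧ height r = k := by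
    rcases le_total 0 k with h0 | h0
    · have h1 : 1 + |2 * ((m + 2) / 2) - 3| = m := by
        rw [abs_of_nonneg (by linarith)]; ring
      refine ⟨(m + 2) / 2, by linarith, by linarith, h1, ?_⟩
      rw [height_of_ge (by linarith), h1, ← hk, abs_of_nonneg h0]
    · have h1 : 1 + |2 * ((4 - m) / 2) - 3| = m := by
        rw [abs_of_nonpos (by linarith)]; ring
      refine ⟨(4 - m) / 2, by linarith, by linarith, h1, ?_⟩
      rw [height_of_le (by linarith), h1, ← hk, abs_of_nonpos h0, neg_neg]
  have hp := radial_pos hr1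
  have hmr : m = r * radial r := by rw [radial_mul hr1, hrm]
  have habs : ∀ x : ℝ, |x / radial r| = |x| / radial r := fun x => by rw [abs_div, abs_of_pos hp]
  have hmax : max |s / radial r| |t / radial r| = r := by
    rw [habs, habs, max_div_div_right hp.le, ← hm, hmr, mul_div_cancel_right₀ _ hp.ne']
  refine ⟨⟨(s / radial r, t / radial r), ?_, ?_, ?_⟩, Subtype.ext ?_⟩
  · exact (le_max_left _ _).trans (hmax.le.trans hr2)
  · exact (le_max_right _ _).trans (hmax.le.trans hr2)
  · exact hr1.trans hmax.ge
  · simp only [annulusMap, hmax, hrk, div_mul_cancel₀ _ hp.ne']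

/-- Either side forces equal maximum norms: the left through the height, the right because only
signs change. The radial factor then cancels, and the two boundary curves give the alternatives `2`
(turning point) and `1` (wall). -/
theorem annulusMap_eq_iff (v v' : annulus) : annulusMap v = annulusMap v' ↔
    (v'.1.1 = v.1.1 ∨ v'.1.1 = -v.1.1 ∧ (|v.1.1| = 2 ∨ |v.1.1| = 1 ∧ |v.1.2| ≤ 1)) ∧
    (v'.1.2 = v.1.2 ∨ v'.1.2 = -v.1.2 ∧ (|v.1.2| = 2 ∨ |v.1.1| ≤ 1 ∧ |v.1.2| = 1)) := by
  obtain ⟨⟨s, t⟩, hs, ht, hr⟩ := v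
  obtain ⟨⟨s', t'⟩, hs', ht', hr'⟩ := v'
  simp only [annulusMap, Subtype.mk.injEq, Prod.mk.injEq]
  dsimp only at hs ht hr hs' ht' hr'
  have key : max |s| |t| = max |s'| |t'| →
      ((wrap (s * radial (max |s| |t|)) = wrap (s' * radial (max |s'| |t'|)) ↔
        (s' = s ∨ s' = -s ∧ (|s| = 2 ∨ |s| = 1 ∧ |t| ≤ 1))) ∧
      (wrap (t * radial (max |s| |t|)) = wrap (t' * radial (max |s'| |t'|)) ↔
        (t' = t ∨ t' = -t ∧ (|t| = 2 ∨ |s| ≤ 1 ∧ |t| = 1)))) := by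
    intro h
    rw [← h]
    have hr2 : max |s| |t| ≤ 2 := max_le hs ht
    obtain ⟨a1, b1⟩ := abs_mul_radial_le hr hr2 (le_max_left _ _)
    obtain ⟨a2, b2⟩ := abs_mul_radial_le hr hr2 (le_max_right _ _)
    obtain ⟨a3, -⟩ := abs_mul_radial_le hr hr2 (h ▸ le_max_left |s'| |t'|)
    obtain ⟨a4, -⟩ := abs_mul_radial_le hr hr2 (h ▸ le_max_right |s'| |t'|)
    have hp := (radial_pos hr).ne'
    rw [wrap_eq_iff a1 a3, wrap_eq_iff a2 a4, b1, b2, mul_left_inj' hp, mul_left_inj' hp,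
      ← neg_mul, ← neg_mul, mul_left_inj' hp, mul_left_inj' hp]
    have e1 : (|s| = max |s| |t| ∧ (max |s| |t| = 1 ∨ max |s| |t| = 2)) ↔
        (|s| = 2 ∨ |s| = 1 ∧ |t| ≤ 1) := by grind
    have e2 : (|t| = max |s| |t| ∧ (max |s| |t| = 1 ∨ max |s| |t| = 2)) ↔
        (|t| = 2 ∨ |s| ≤ 1 ∧ |t| = 1) := by grind
    rw [e1, e2]
    exact ⟨Iff.rfl, Iff.rfl⟩
  constructor
  · rintro ⟨⟨h1, h2⟩, h3⟩
    obtain ⟨k1, k2⟩ := key (injOn_height ⟨hr, max_le hs ht⟩ ⟨hr', max_le hs' ht'⟩ h3)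
    exact ⟨k1.1 h1, k2.1 h2⟩
  · rintro ⟨h1, h2⟩
    have e1 : |s'| = |s| := abs_eq_abs.2 (h1.imp_right And.left)
    have e2 : |t'| = |t| := abs_eq_abs.2 (h2.imp_right And.left)
    have h : max |s| |t| = max |s'| |t'| := by rw [e1, e2]
    obtain ⟨k1, k2⟩ := key h
    exact ⟨⟨k1.2 h1, k2.2 h2⟩, by rw [h]⟩

theorem isGenusTwoSurface_of_mem_Ioo {V₁ V₂ : ℝ → ℝ} (hV₁ : IsStepPotential V₁)
    (hV₂ : IsStepPotential V₂) {w : ℝ × ℝ} (hw₁ : w.1 ≠ 0) (hw₂ : w.2 ≠ 0) {h e : ℝ}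
    (he : V₁ w.1 < e) (he' : V₂ w.2 < h - e) :
    IsGenusTwoSurface (levelSet V₁ V₂ w h e) := by
  obtain ⟨q₁, p₁, h₁⟩ := exists_levelParam hV₁ ((hV₁.pos hw₁).trans he) he
  obtain ⟨q₂, p₂, h₂⟩ := exists_levelParam hV₂ ((hV₂.pos hw₂).trans he') he'
  obtain ⟨φ⟩ := nonempty_homeomorph_embeddedDouble
  obtain ⟨ψ⟩ := nonempty_homeomorph_levelSet (w := w) h₁ h₂ (K := annulus) (f := annulusMap)
    (isClosed_abs_le.1.inter (isClosed_abs_le.2.inter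
      (isClosed_le continuous_const (continuous_fst.abs.max continuous_snd.abs))))
    (fun v => by
      refine and_congr_right fun _ => and_congr_right fun _ => ?_
      simp only [step, mem_ofPred_eq, h₁.lt_wall, h₂.lt_wall]
      rw [← max_lt_iff, not_lt])
    continuous_annulusMap surjective_annulusMap
    (fun v v' => by
      rw [annulusMap_eq_iff, h₁.eq_wall, h₁.le_wall, h₂.eq_wall, h₂.le_wall])
  exact ⟨ψ.trans φ⟩

/-! ### Distinguishing the two genera -/

/-- Any three maps to the circle are multiplicatively dependent up to homotopy: some nontrivial
monomial in them has a continuous logarithm. -/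
def HasMonomialLogs (X : Type) [TopologicalSpace X] : Prop :=
  ∀ f₁ f₂ f₃ : C(X, Circle), ∃ a b c : ℤ, (a ≠ 0 ∨ b ≠ 0 ∨ c ≠ 0) ∧
    ∃ g : C(X, ℝ), ∀ x, Circle.exp (g x) = f₁ x ^ a * f₂ x ^ b * f₃ x ^ c

theorem HasMonomialLogs.of_homeomorph {X Y : Type} [TopologicalSpace X] [TopologicalSpace Y]
    (φ : X ≃ₜ Y) (hX : HasMonomialLogs X) : HasMonomialLogs Y := by
  intro f₁ f₂ f₃
  obtain ⟨a, b, c, h0, g, hg⟩ := hX (f₁.comp φ) (f₂.comp φ) (f₃.comp φ)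
  refine ⟨a, b, c, h0, g.comp φ.symm, fun y => ?_⟩
  have := hg (φ.symm y)
  simpa using this

/-- A map from the torus to the circle lifts to a map from the plane to the line that is periodic
up to constants. -/
theorem exists_lift_of_torus (f : C(Circle × Circle, Circle)) :
    ∃ (F : C(ℝ × ℝ, ℝ)) (m n : ℤ),
      (∀ s t, Circle.exp (F (s, t)) = f (Circle.exp s, Circle.exp t)) ∧
      (∀ s t, F (s + 2 * Real.pi, t) = F (s, t) + m * (2 * Real.pi)) ∧
      (∀ s t, F (s, t + 2 * Real.pi) = F (s, t) + n * (2 * Real.pi)) := by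
  let f' : C(ℝ × ℝ, Circle) := f.comp ⟨fun v => (Circle.exp v.1, Circle.exp v.2), by fun_prop⟩
  obtain ⟨y, hy⟩ := Circle.exp_surjective (f' (0, 0))
  obtain ⟨F, ⟨-, hF⟩, -⟩ := Circle.isCoveringMap_exp.existsUnique_continuousMap_lifts f' (0, 0) y hy
  have hF' : ∀ s t, Circle.exp (F (s, t)) = f (Circle.exp s, Circle.exp t) := fun s t =>
    congrFun hF (s, t)
  -- `F ∘ τ` and a translate of `F` by a multiple of `2π` lift the same map and agree at the origin,
  -- hence everywhere on the connected plane.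
  have shift : ∀ τ : C(ℝ × ℝ, ℝ × ℝ), (∀ v, f' (τ v) = f' v) →
      ∃ m : ℤ, ∀ v, F (τ v) = F v + m * (2 * Real.pi) := by
    intro τ hτ
    obtain ⟨m, hm⟩ := Circle.exp_eq_exp.1
      (((congrFun hF (τ (0, 0))).trans (hτ (0, 0))).trans (congrFun hF (0, 0)).symm)
    refine ⟨m, congrFun (Circle.isCoveringMap_exp.eq_of_comp_eq
      (g₁ := fun v => F (τ v)) (g₂ := fun v => F v + m * (2 * Real.pi))
      (by fun_prop) (by fun_prop) (funext fun v => ?_) (0, 0) hm)⟩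
    have h1 : Circle.exp (F (τ v)) = f' (τ v) := congrFun hF (τ v)
    have h2 : Circle.exp (F v) = f' v := congrFun hF v
    simp only [Function.comp_apply]
    rw [h1, hτ, Circle.exp_add, Circle.exp_int_mul_two_pi, mul_one, h2]
  obtain ⟨m, hm⟩ := shift ⟨fun v => (v.1 + 2 * Real.pi, v.2), by fun_prop⟩ fun v => by
    simp only [f', ContinuousMap.comp_apply, ContinuousMap.coe_mk, Circle.exp_add_two_pi]
  obtain ⟨n, hn⟩ := shift ⟨fun v => (v.1, v.2 + 2 * Real.pi), by fun_prop⟩ fun v => by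
    simp only [f', ContinuousMap.comp_apply, ContinuousMap.coe_mk, Circle.exp_add_two_pi]
  exact ⟨F, m, n, hF', fun s t => hm (s, t), fun s t => hn (s, t)⟩

/-- The cross product of the two rows is a relation; when its last entry vanishes, the first two
columns are already dependent. -/
theorem exists_int_relation (m₁ n₁ m₂ n₂ m₃ n₃ : ℤ) : ∃ a b c : ℤ, (a ≠ 0 ∨ b ≠ 0 ∨ c ≠ 0) ∧
    a * m₁ + b * m₂ + c * m₃ = 0 ∧ a * n₁ + b * n₂ + c * n₃ = 0 := by
  by_cases h : m₁ * n₂ = m₂ * n₁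
  · by_cases hm : m₁ = 0
    · by_cases hn : n₁ = 0
      · exact ⟨1, 0, 0, by simp, by simp [hm], by simp [hn]⟩
      · exact ⟨-n₂, n₁, 0, by simp [hn], by linarith, by ring⟩
    · exact ⟨-m₂, m₁, 0, by simp [hm], by ring, by linarith⟩
  · exact ⟨m₂ * n₃ - m₃ * n₂, m₃ * n₁ - m₁ * n₃, m₁ * n₂ - m₂ * n₁,
      Or.inr (Or.inr (sub_ne_zero.2 h)), by ring, by ring⟩

theorem isQuotientMap_expProd :
    IsQuotientMap fun v : ℝ × ℝ => (Circle.exp v.1, Circle.exp v.2) := by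
  have ho : IsOpenMap (Prod.map Circle.exp Circle.exp) :=
    isLocalHomeomorph_circleExp.isOpenMap.prodMap isLocalHomeomorph_circleExp.isOpenMap
  exact ho.isQuotientMap (Circle.exp.continuous.prodMap Circle.exp.continuous)
    (Circle.exp_surjective.prodMap Circle.exp_surjective)

/-- The exponents are chosen to cancel both periods of the combined lift, which then descends from
the plane. -/
theorem hasMonomialLogs_torus : HasMonomialLogs (Circle × Circle) := by
  intro f₁ f₂ f₃
  obtain ⟨F₁, m₁, n₁, h₁, hm₁, hn₁⟩ := exists_lift_of_torus f₁
  obtain ⟨F₂, m₂, n₂, h₂, hm₂, hn₂⟩ := exists_lift_of_torus f₂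
  obtain ⟨F₃, m₃, n₃, h₃, hm₃, hn₃⟩ := exists_lift_of_torus f₃
  obtain ⟨a, b, c, h0, hm, hn⟩ := exists_int_relation m₁ n₁ m₂ n₂ m₃ n₃
  refine ⟨a, b, c, h0, ?_⟩
  have hm' : (a * m₁ + b * m₂ + c * m₃ : ℝ) = 0 := by exact_mod_cast hm
  have hn' : (a * n₁ + b * n₂ + c * n₃ : ℝ) = 0 := by exact_mod_cast hn
  let G : C(ℝ × ℝ, ℝ) := ⟨fun v => a * F₁ v + b * F₂ v + c * F₃ v, by fun_prop⟩
  have p₁ : ∀ t, Function.Periodic (fun s => G (s, t)) (2 * Real.pi) := fun t s => by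
    simp only [G, ContinuousMap.coe_mk, hm₁, hm₂, hm₃]
    linear_combination 2 * Real.pi * hm'
  have p₂ : ∀ s, Function.Periodic (fun t => G (s, t)) (2 * Real.pi) := fun s t => by
    simp only [G, ContinuousMap.coe_mk, hn₁, hn₂, hn₃]
    linear_combination 2 * Real.pi * hn'
  let π : C(ℝ × ℝ, Circle × Circle) := ⟨_, isQuotientMap_expProd.continuous⟩
  have hG : ∀ v v', π v = π v' → G v = G v' := by
    rintro ⟨s, t⟩ ⟨s', t'⟩ h
    obtain ⟨h1, h2⟩ := Prod.mk.inj h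
    obtain ⟨k, rfl⟩ := Circle.exp_eq_exp.1 h1
    obtain ⟨l, rfl⟩ := Circle.exp_eq_exp.1 h2
    exact ((p₁ _).int_mul k s').trans ((p₂ s').int_mul l t')
  have hπ : IsQuotientMap π := isQuotientMap_expProd
  refine ⟨hπ.lift G hG, fun x => ?_⟩
  obtain ⟨⟨s, t⟩, rfl⟩ := hπ.surjective x
  have h4 : hπ.lift G hG (π (s, t)) = G (s, t) := DFunLike.congr_fun (hπ.lift_comp G hG) (s, t)
  have h5 : π (s, t) = (Circle.exp s, Circle.exp t) := rfl
  rw [h4, h5, ← h₁, ← h₂, ← h₃]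
  simp only [G, ContinuousMap.coe_mk, Circle.exp_add]
  simp only [← zsmul_eq_mul, Circle.exp_zsmul]

/-- The map of degree one from the circle to itself which collapses the left half. -/
noncomputable def collapse (z : Circle) : Circle :=
  if (z : ℂ).re ≤ 0 then 1 else Circle.exp Real.pi * z ^ 2

theorem collapse_of_le {z : Circle} (hz : (z : ℂ).re ≤ 0) : collapse z = 1 := if_pos hz

/-- On the imaginary axis `z ^ 2 = -1`, so the two branches agree there. -/
theorem collapse_of_ge {z : Circle} (hz : 0 ≤ (z : ℂ).re) :
    collapse z = Circle.exp Real.pi * z ^ 2 := by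
  rcases hz.lt_or_eq with h | h
  · exact if_neg h.not_ge
  · rw [collapse_of_le h.symm.le]
    have h1 : Complex.normSq z = 1 := Circle.normSq_coe z
    rw [Complex.normSq_apply, ← h] at h1
    refine Circle.ext ?_
    rw [Circle.coe_one, Circle.coe_mul, Circle.coe_exp, Complex.exp_pi_mul_I, Circle.coe_pow]
    apply Complex.ext
    · simp [pow_two, ← h]
      linarith
    · simp [pow_two, ← h]

theorem continuous_collapse : Continuous collapse := by
  have : collapse = fun z : Circle => if (z : ℂ).re ≤ 0 then 1 else Circle.exp Real.pi * z ^ 2 := rfl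
  rw [this]
  refine Continuous.if_le continuous_const (by fun_prop) continuous_circle_re continuous_const ?_
  intro z hz
  rw [← collapse_of_le hz.le, collapse_of_ge hz.ge]

/-- A power of the collapse has no continuous logarithm unless the exponent vanishes. -/
theorem eq_zero_of_log_collapse {g : C(Circle, ℝ)} {k : Circle} {a : ℤ}
    (h : ∀ z, Circle.exp (g z) = k * collapse z ^ a) : a = 0 := by
  have hpi := Real.pi_pos
  have hre : ∀ t : ℝ, (Circle.exp t : ℂ).re = Real.cos t := fun t => by
    rw [Circle.coe_exp, Complex.exp_ofReal_mul_I_re]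
  -- Across the right half `g` follows slope `2 * a` and gains `2πa`; on the left half it is
  -- constant. The circle closes up only if `a = 0`.
  have right : g (Circle.exp (Real.pi / 2)) - 2 * a * (Real.pi / 2) =
      g (Circle.exp (-(Real.pi / 2))) - 2 * a * (-(Real.pi / 2)) := by
    refine Circle.isCoveringMap_exp.constOn_of_comp (A := ℝ)
      (g := fun t => g (Circle.exp t) - 2 * a * t) (s := Icc (-(Real.pi / 2)) (Real.pi / 2))
      isPreconnected_Icc (by fun_prop) ?_ ⟨by linarith, le_rfl⟩ ⟨le_rfl, by linarith⟩
    have : ∀ t ∈ Icc (-(Real.pi / 2)) (Real.pi / 2),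
        Circle.exp (g (Circle.exp t) - 2 * a * t) = k * Circle.exp Real.pi ^ a := by
      intro t ht
      have double : Circle.exp (2 * a * t) = (Circle.exp t ^ 2) ^ a := by
        rw [← Circle.exp_natCast_mul, ← Circle.exp_intCast_mul]
        push_cast
        ring_nf
      rw [Circle.exp_sub, h, collapse_of_ge (by rw [hre]; exact Real.cos_nonneg_of_mem_Icc ht),
        mul_zpow, ← mul_assoc, double, mul_div_cancel_right]
    intro t ht t' ht'
    rw [this t ht, this t' ht']
  have left : g (Circle.exp (Real.pi / 2)) = g (Circle.exp (Real.pi + Real.pi / 2)) := by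
    refine Circle.isCoveringMap_exp.constOn_of_comp (A := ℝ)
      (g := fun t => g (Circle.exp t)) (s := Icc (Real.pi / 2) (Real.pi + Real.pi / 2))
      isPreconnected_Icc (by fun_prop) ?_ ⟨le_rfl, by linarith⟩ ⟨by linarith, le_rfl⟩
    have : ∀ t ∈ Icc (Real.pi / 2) (Real.pi + Real.pi / 2), Circle.exp (g (Circle.exp t)) = k := by
      intro t ht
      rw [h, collapse_of_le (by rw [hre]; exact Real.cos_nonpos_of_pi_div_two_le_of_le ht.1 ht.2),
        one_zpow, mul_one]
    intro t ht t' ht'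
    rw [this t ht, this t' ht']
  have period : Circle.exp (Real.pi + Real.pi / 2) = Circle.exp (-(Real.pi / 2)) :=
    Circle.exp_eq_exp.2 ⟨1, by push_cast; ring⟩
  rw [period] at left
  have : (a : ℝ) * Real.pi = 0 := by linarith
  exact_mod_cast (mul_eq_zero.1 this).resolve_right hpi.ne'

/-- `collapse` is `1` on the seam, so a collapsed coordinate of one copy extends by `1` to the
other. Both coordinates of the first copy and one of the second give three maps, and restriction to
coordinate circles isolates each exponent. -/
theorem not_hasMonomialLogs_doubleTorus : ¬ HasMonomialLogs DoubleTorus := by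
  intro hD
  have fold : ∀ u v : HoledTorus → Circle, Continuous u → Continuous v →
      (∀ x : HoledTorus, (x.1.1 : ℂ).re ≤ 0 → (x.1.2 : ℂ).re ≤ 0 → u x = v x) →
      ∃ f : C(DoubleTorus, Circle), (∀ x, f (Quot.mk _ (Sum.inl x)) = u x) ∧
        ∀ x, f (Quot.mk _ (Sum.inr x)) = v x := by
    intro u v hu hv huv
    refine ⟨⟨Quot.lift (Sum.elim u v) ?_, continuous_quot_lift _ (hu.sumElim hv)⟩,
      fun x => rfl, fun x => rfl⟩
    rintro _ _ ⟨x, h₁, h₂⟩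
    exact huv x h₁ h₂
  have c₁ : Continuous fun x : HoledTorus => collapse x.1.1 :=
    continuous_collapse.comp (continuous_fst.comp continuous_subtype_val)
  have c₂ : Continuous fun x : HoledTorus => collapse x.1.2 :=
    continuous_collapse.comp (continuous_snd.comp continuous_subtype_val)
  obtain ⟨f₁, l₁, r₁⟩ := fold _ (fun _ => 1) c₁ continuous_const fun x h _ => collapse_of_le h
  obtain ⟨f₂, l₂, r₂⟩ := fold _ (fun _ => 1) c₂ continuous_const fun x _ h => collapse_of_le h
  obtain ⟨f₃, l₃, r₃⟩ := fold (fun _ => 1) _ continuous_const c₁ fun x h _ => (collapse_of_le h).symm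
  obtain ⟨a, b, c, h0, g, hg⟩ := hD f₁ f₂ f₃
  let i : C(Circle, HoledTorus) := ⟨fun z => ⟨(z, 1), fun h => by
    have := h.2
    norm_num at this⟩, Continuous.subtype_mk (by fun_prop) _⟩
  let j : C(Circle, HoledTorus) := ⟨fun z => ⟨(1, z), fun h => by
    have := h.1
    norm_num at this⟩, Continuous.subtype_mk (by fun_prop) _⟩
  let inl : C(HoledTorus, DoubleTorus) :=
    ⟨fun x => Quot.mk _ (Sum.inl x), continuous_quot_mk.comp continuous_inl⟩
  let inr : C(HoledTorus, DoubleTorus) :=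
    ⟨fun x => Quot.mk _ (Sum.inr x), continuous_quot_mk.comp continuous_inr⟩
  have ha : a = 0 := by
    refine eq_zero_of_log_collapse (g := g.comp (inl.comp i)) (k := collapse 1 ^ b) fun z => ?_
    refine (hg _).trans ?_
    change f₁ (Quot.mk _ (Sum.inl (i z))) ^ a * f₂ (Quot.mk _ (Sum.inl (i z))) ^ b *
      f₃ (Quot.mk _ (Sum.inl (i z))) ^ c = _
    rw [l₁, l₂, l₃, one_zpow, mul_one, mul_comm]
    rfl
  have hb : b = 0 := by
    refine eq_zero_of_log_collapse (g := g.comp (inl.comp j)) (k := collapse 1 ^ a) fun z => ?_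
    refine (hg _).trans ?_
    change f₁ (Quot.mk _ (Sum.inl (j z))) ^ a * f₂ (Quot.mk _ (Sum.inl (j z))) ^ b *
      f₃ (Quot.mk _ (Sum.inl (j z))) ^ c = _
    rw [l₁, l₂, l₃, one_zpow, mul_one]
    rfl
  have hc : c = 0 := by
    refine eq_zero_of_log_collapse (g := g.comp (inr.comp i)) (k := 1) fun z => ?_
    refine (hg _).trans ?_
    change f₁ (Quot.mk _ (Sum.inr (i z))) ^ a * f₂ (Quot.mk _ (Sum.inr (i z))) ^ b *
      f₃ (Quot.mk _ (Sum.inr (i z))) ^ c = _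
    rw [r₁, r₂, r₃, one_zpow, one_zpow, one_mul]
    rfl
  simp [ha, hb, hc] at h0

theorem isEmpty_homeomorph {X Y : Type} [TopologicalSpace X] [TopologicalSpace Y]
    (hX : IsGenusOneSurface X) (hY : IsGenusTwoSurface Y) : IsEmpty (X ≃ₜ Y) := by
  obtain ⟨φ⟩ := hX
  obtain ⟨ψ⟩ := hY
  exact ⟨fun χ => not_hasMonomialLogs_doubleTorus
    (hasMonomialLogs_torus.of_homeomorph ((φ.symm.trans χ).trans ψ))⟩

/-! ### Regular and singular energies -/

theorem isRegularValue_of_mem_Ioo {V₁ V₂ : ℝ → ℝ} {w : ℝ × ℝ} {h a b c : ℝ} {M : Type}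
    [TopologicalSpace M] (hM : ∀ e ∈ Ioo a b, Nonempty (levelSet V₁ V₂ w h e ≃ₜ M))
    (hc : c ∈ Ioo a b) : IsRegularValue V₁ V₂ w h c := by
  filter_upwards [Ioo_mem_nhds hc.1 hc.2] with e he
  obtain ⟨φ⟩ := hM e he
  obtain ⟨ψ⟩ := hM c hc
  exact ⟨φ.trans ψ.symm⟩

/-- A regular value would make leaves on its two sides homeomorphic through the leaf at `c`, whose
own topology need not be known. -/
theorem not_isRegularValue {V₁ V₂ : ℝ → ℝ} {w : ℝ × ℝ} {h a b c : ℝ} (hac : a < c) (hcb : c < b)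
    (hne : ∀ e ∈ Ioo a c, ∀ e' ∈ Ioo c b,
      IsEmpty (levelSet V₁ V₂ w h e ≃ₜ levelSet V₁ V₂ w h e')) :
    ¬ IsRegularValue V₁ V₂ w h c := by
  intro hreg
  have left : ∀ᶠ e in 𝓝[<] c, e ∈ Ioo a c := Ioo_mem_nhdsLT hac
  have right : ∀ᶠ e in 𝓝[>] c, e ∈ Ioo c b := Ioo_mem_nhdsGT hcb
  obtain ⟨e, he, ⟨φ⟩⟩ := (left.and (hreg.filter_mono nhdsWithin_le_nhds)).exists
  obtain ⟨e', he', ⟨ψ⟩⟩ := (right.and (hreg.filter_mono nhdsWithin_le_nhds)).exists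
  exact (hne e he e' he').false (φ.trans ψ.symm)

end StepSystem

theorem mainTheorem5 (V₁ V₂ : ℝ → ℝ)
    (hV₁ : StepSystem.IsStepPotential V₁) (hV₂ : StepSystem.IsStepPotential V₂)
    (w : ℝ × ℝ) (hw₁ : w.1 ≠ 0) (hw₂ : w.2 ≠ 0)
    (h : ℝ) (hh : V₁ w.1 + V₂ w.2 < h) :
    (0 < V₁ w.1 ∧ V₁ w.1 < h - V₂ w.2 ∧ h - V₂ w.2 < h) ∧
    (∀ e ∈ Set.Ioo 0 (V₁ w.1),
      StepSystem.IsGenusOneSurface (StepSystem.levelSet V₁ V₂ w h e)) ∧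
    (∀ e ∈ Set.Ioo (V₁ w.1) (h - V₂ w.2),
      StepSystem.IsGenusTwoSurface (StepSystem.levelSet V₁ V₂ w h e)) ∧
    (∀ e ∈ Set.Ioo (h - V₂ w.2) h,
      StepSystem.IsGenusOneSurface (StepSystem.levelSet V₁ V₂ w h e)) ∧
    (∀ e ∈ Set.Ioo 0 (V₁ w.1) ∪ Set.Ioo (h - V₂ w.2) h,
      ∀ e' ∈ Set.Ioo (V₁ w.1) (h - V₂ w.2),
        IsEmpty (StepSystem.levelSet V₁ V₂ w h e ≃ₜ StepSystem.levelSet V₁ V₂ w h e')) ∧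
    {c ∈ Set.Ioo 0 h | ¬ StepSystem.IsRegularValue V₁ V₂ w h c} =
      {V₁ w.1, h - V₂ w.2} := by
  have pos₁ := hV₁.pos hw₁
  have pos₂ := hV₂.pos hw₂
  have low : ∀ e ∈ Set.Ioo 0 (V₁ w.1),
      StepSystem.IsGenusOneSurface (StepSystem.levelSet V₁ V₂ w h e) := fun e he =>
    StepSystem.isGenusOneSurface_of_lt hV₁ hV₂ hw₁ hh he.1 he.2 (by linarith [he.2])
  have middle : ∀ e ∈ Set.Ioo (V₁ w.1) (h - V₂ w.2),
      StepSystem.IsGenusTwoSurface (StepSystem.levelSet V₁ V₂ w h e) := fun e he =>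
    StepSystem.isGenusTwoSurface_of_mem_Ioo hV₁ hV₂ hw₁ hw₂ he.1 (by linarith [he.2])
  have high : ∀ e ∈ Set.Ioo (h - V₂ w.2) h,
      StepSystem.IsGenusOneSurface (StepSystem.levelSet V₁ V₂ w h e) := fun e he => by
    -- After the exchange the horizontal energy is `h - e`, below the other step height.
    obtain ⟨φ⟩ := StepSystem.isGenusOneSurface_of_lt hV₂ hV₁ (w := w.swap) (h := h) (e := h - e)
      hw₂ (by simpa [add_comm] using hh) (by linarith [he.2])
      (by simpa using (by linarith [he.1] : h - e < V₂ w.2)) (by linarith [he.1])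
    exact ⟨(StepSystem.levelSetSwap V₁ V₂ w h e).trans φ⟩
  have distinct : ∀ e ∈ Set.Ioo 0 (V₁ w.1) ∪ Set.Ioo (h - V₂ w.2) h,
      ∀ e' ∈ Set.Ioo (V₁ w.1) (h - V₂ w.2),
        IsEmpty (StepSystem.levelSet V₁ V₂ w h e ≃ₜ StepSystem.levelSet V₁ V₂ w h e') :=
    fun e he e' he' => StepSystem.isEmpty_homeomorph (he.elim (low e) (high e)) (middle e' he')
  refine ⟨⟨pos₁, by linarith, by linarith⟩, low, middle, high, distinct, ?_⟩
  ext c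
  simp only [Set.mem_ofPred_eq, Set.mem_insert_iff, Set.mem_singleton_iff]
  constructor
  · rintro ⟨⟨h0, h1⟩, hc⟩
    by_contra! hne
    refine hc ?_
    rcases hne.1.lt_or_gt with h2 | h2
    · exact StepSystem.isRegularValue_of_mem_Ioo low ⟨h0, h2⟩
    · rcases hne.2.lt_or_gt with h3 | h3
      · exact StepSystem.isRegularValue_of_mem_Ioo middle ⟨h2, h3⟩
      · exact StepSystem.isRegularValue_of_mem_Ioo high ⟨h3, h1⟩
  · rintro (rfl | rfl)
    · exact ⟨⟨pos₁, by linarith⟩, StepSystem.not_isRegularValue pos₁ (b := h - V₂ w.2)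
        (by linarith) fun e he => distinct e (Or.inl he)⟩
    · refine ⟨⟨by linarith, by linarith⟩, StepSystem.not_isRegularValue (a := V₁ w.1) (b := h)
        (by linarith) (by linarith) fun e he e' he' => ?_⟩
      have := distinct e' (Or.inr he') e he
      exact ⟨fun φ => this.false φ.symm⟩
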